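/- Let $\mathcal{H}_n$ ($n\ge 0$) be the hyperoctahedral group, i.e. the group of all permutations of $\{1,\dots,2n\}$ that send each block $p(i)=\{2i-1,2i\}$, $1\le i\le n$, onto a block. An element $\omega\in\mathcal{H}_n$ induces a permutation $p_\omega$ of the $n$ blocks. For each cycle of $p_\omega$ (fixed points included), of length $m$ say, the $2m$ points of its blocks form either two cycles of $\omega$ of length $m$ or a single cycle of $\omega$ of length $2m$. Let $\lambda$ be the partition with one part $m$ for each cycle of $p_\omega$ of the first kind, and $\delta$ the partition with one part $m$ for each cycle of the second kind. The pair $(\lambda,\delta)$, for which $|\lambda|+|\delta|=n$, is the type of $\omega$. A pair of partitions $(\lambda,\delta)$ is called proper if $\lambda$ has no part equal to $1$. For a proper pair $x=(\lambda,\delta)$ put $|x|=|\lambda|+|\delta|$, and for $n\ge|x|$ let $\mathbf{C}_x(n)\in\mathbb{C}[\mathcal{H}_n]$ be the sum of all elements of $\mathcal{H}_n$ of type $(\lambda\cup(1^{n-|x|}),\delta)$. For each $n$ the elements $\mathbf{C}_z(n)$, where $z$ runs over the proper pairs with $|z|\le n$, form a basis of the center of $\mathbb{C}[\mathcal{H}_n]$.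 For proper pairs $x,y$ with $|x|,|y|\le n$ the structure coefficients $c_{xy}^{z}(n)$ are defined by $$\mathbf{C}_x(n)\,\mathbf{C}_y(n)=\sum_{|z|\le n}c_{xy}^{z}(n)\,\mathbf{C}_z(n).$$ Let $x=(\lambda_1,\delta_1)$, $y=(\lambda_2,\delta_2)$ and $h=(\lambda_3,\delta_3)$ be three proper pairs of partitions. Then there is a polynomial $P\in\mathbb{Q}[X]$ such that $c_{xy}^{h}(n)=P(n)$ for every integer $n\ge\max(|x|,|y|,|h|)$. Its coefficients in the basis of falling factorials of $X-|h|$ are non-negative, that is, $$P(X)=\sum_{j\ge0}a_j\,(X-|h|)(X-|h|-1)\cdots(X-|h|-j+1)$$ with rational numbers $a_j\ge0$, only finitely many of them nonzero. Moreover $$\deg P\le|\lambda_1|+|\delta_1|+|\lambda_2|+|\delta_2|-|\lambda_3|-|\delta_3|,$$ where $\deg 0=-\infty$; in particular $P=0$ if the right-hand side is negative. -/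

import Mathlib

open Polynomial

noncomputable section

namespace Hyperoctahedral

/-- The `2`-tuple (block) number `i` of the ground set. The pair `(i, b)` of `Fin n × Fin 2`
stands for the `b`-th of the two consecutive points of `{1, …, 2n}` in the `i`-th `2`-tuple. -/
def block {n : ℕ} (i : Fin n) : Set (Fin n × Fin 2) := {a | a.1 = i}

theorem fst_eq_of_image {n : ℕ} {w : Equiv.Perm (Fin n × Fin 2)} {r r' : Fin n}
    (h : w '' block r = block r') {a : Fin n × Fin 2} (ha : a.1 = r) : (w a).1 = r' := by
  have : w a ∈ w '' block r := ⟨a, ha, rfl⟩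
  rw [h] at this
  exact this

/-- The hyperoctahedral group on `2n` points: all permutations that send every block onto
a block. -/
def H (n : ℕ) : Subgroup (Equiv.Perm (Fin n × Fin 2)) where
  carrier := {w | ∀ r : Fin n, ∃ r' : Fin n, w '' block r = block r'}
  one_mem' := fun r => ⟨r, by simp⟩
  mul_mem' := by
    intro u v hu hv r
    obtain ⟨s, hs⟩ := hv r
    obtain ⟨t, ht⟩ := hu s
    exact ⟨t, by rw [Equiv.Perm.coe_mul, Set.image_comp, hs, ht]⟩
  inv_mem' := by
    intro w hw r
    obtain ⟨t, ht⟩ := hw (w⁻¹ (r, 0)).1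
    have h0 := fst_eq_of_image ht (a := w⁻¹ (r, 0)) rfl
    have h1 : r = t := by simpa using h0
    subst h1
    refine ⟨(w⁻¹ (r, 0)).1, ?_⟩
    rw [← ht, ← Set.image_comp, ← Equiv.Perm.coe_mul]
    simp

instance (n : ℕ) : Fintype (H n) := Fintype.ofFinite _

theorem fst_apply_eq {n : ℕ} (w : H n) {a b : Fin n × Fin 2} (h : a.1 = b.1) :
    (w.1 a).1 = (w.1 b).1 := by
  obtain ⟨t, ht⟩ := w.2 b.1
  rw [fst_eq_of_image ht h, fst_eq_of_image ht rfl]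

/-- The permutation `p_w` of the `n` blocks induced by `w`. -/
def blockPerm {n : ℕ} (w : H n) : Equiv.Perm (Fin n) where
  toFun i := (w.1 (i, 0)).1
  invFun i := ((w⁻¹).1 (i, 0)).1
  left_inv i := by
    have h := fst_apply_eq (w⁻¹) (a := ((w.1 (i, 0)).1, 0)) (b := w.1 (i, 0)) rfl
    simpa using h
  right_inv i := by
    have h := fst_apply_eq w (a := (((w⁻¹).1 (i, 0)).1, 0)) (b := (w⁻¹).1 (i, 0)) rfl
    simpa using h

open Classical in
/-- The cycles of `p_w` (fixed points included), as sets of block numbers. -/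
def blockCycles {n : ℕ} (w : H n) : Finset (Finset (Fin n)) :=
  Finset.univ.image fun i => Finset.univ.filter fun j => (blockPerm w).SameCycle i j

/-- The two points of block `i` lie in one and the same cycle of `w`; otherwise the block is split
between two different cycles of `w`. -/
def Joined {n : ℕ} (w : H n) (i : Fin n) : Prop := w.1.SameCycle (i, 0) (i, 1)

open Classical in
/-- The type of `w`. A cycle of length `m` of `p_w` contributes a part `m` to the
first partition, `w(1,1)`, if above it `w` has two cycles of length `m`, interchanged by `a ↦ ā`, and
to the second partition, `w(2)`, if above it `w` has a single cycle, of length `2m`. -/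
def type {n : ℕ} (w : H n) : Multiset ℕ × Multiset ℕ :=
  (((blockCycles w).filter fun B => ∀ i ∈ B, ¬ Joined w i).val.map Finset.card,
   ((blockCycles w).filter fun B => ∀ i ∈ B, Joined w i).val.map Finset.card)

/-- A partition, given as the finite multiset of its parts. -/
def IsPartition (s : Multiset ℕ) : Prop := ∀ i ∈ s, 1 ≤ i

/-- A proper pair of partitions `(lam, del)`: the first partition has no part equal to `1`. -/
structure ProperPair where
  lam : Multiset ℕ
  del : Multiset ℕ
  isPartition_lam : IsPartition lam
  isPartition_del : IsPartition del
  proper : 1 ∉ lam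

/-- The total size `|lam| + |del|`. -/
def ProperPair.size (x : ProperPair) : ℕ := x.lam.sum + x.del.sum

/-- `(lam ∪ (1 ^ (n - |lam| - |del|)), del)`, meant for `n ≥ |lam| + |del|`. -/
def ProperPair.complete (x : ProperPair) (n : ℕ) : Multiset ℕ × Multiset ℕ :=
  (x.lam + Multiset.replicate (n - x.size) 1, x.del)

open Classical in
/-- The formal sum, in the group algebra `ℂ[H n]`, of the elements of the completed type. -/
def classSum (x : ProperPair) (n : ℕ) : MonoidAlgebra ℂ (H n) :=
  ∑ t ∈ Finset.univ.filter (fun t : H n => type t = x.complete n), MonoidAlgebra.of ℂ (H n) t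

/-- The center of the group algebra `ℂ[H n]`. -/
abbrev Z (n : ℕ) : Subalgebra ℂ (MonoidAlgebra ℂ (H n)) :=
  Subalgebra.center ℂ (MonoidAlgebra ℂ (H n))

/-- `∑ j, a j * (X - m) (X - m - 1) ⋯ (X - m - j + 1)`: the polynomial whose coefficients in the
basis of falling factorials of `X - m` are the `a j`. -/
def fallingSum (m : ℕ) (a : ℕ →₀ ℚ) : ℚ[X] :=
  a.sum fun j c => C c * (descPochhammer ℚ j).comp (X - C (m : ℚ))

end Hyperoctahedral

end

noncomputable section

namespace Hyperoctahedral

/-! The type is a complete conjugacy invariant and every admissible type occurs, so the class sums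
form a basis of the center (`classBasis`). The coefficient of `h` in a product is then the number of
factorizations `u * v = t`, with `u` and `v` of the completed types of `x` and `y`, of any one `t`
of completed type `h` (`classBasis_repr_mul`).

Take `t` to be the extension by the identity of an element of `H h.size` fixing no block pointwise,
and put `k = n - h.size`. Sort the factorizations by the set `T` of extra blocks moved by `u` or
`v`; the first `h.size` blocks are always moved, since `t` moves them. A factorization with given
`T` is the extension of one in `H (h.size + j)`, `j = T.card`, that moves all blocks. The number `N
j` of these does not depend on `n` or on the choice of `T`, so the count is `∑ k.choose j * N j`
(`card_factorizations_eq_sum`). Hence `a j = N j / j!`, visibly non-negative.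

By properness `u` moves exactly `x.size` blocks and `v` exactly `y.size`, so `N j = 0` unless
`h.size + j ≤ x.size + y.size`. This gives both finiteness and the degree bound. -/

/-! ### Block permutations, signatures and types -/

theorem fst_apply {n : ℕ} (w : H n) (a : Fin n × Fin 2) : (w.1 a).1 = blockPerm w a.1 :=
  fst_apply_eq w (b := (a.1, 0)) rfl

/-- Passing to the permutation of the blocks is a group homomorphism. -/
def blockHom (n : ℕ) : H n →* Equiv.Perm (Fin n) where
  toFun := blockPerm
  map_one' := by ext i; rfl
  map_mul' u v := by
    ext i
    change ((u.1 (v.1 (i, 0))).1 : ℕ) = _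
    rw [fst_apply]
    rfl

theorem fst_zpow_apply {n : ℕ} (w : H n) (k : ℤ) (a : Fin n × Fin 2) :
    ((w.1 ^ k) a).1 = (blockPerm w ^ k) a.1 := by
  have h := fst_apply (w ^ k) a
  rw [show blockPerm (w ^ k) = blockPerm w ^ k from map_zpow (blockHom n) w k] at h
  exact h

theorem semiconj_zpow {A B : Type*} {p : Equiv.Perm A} {q : Equiv.Perm B} {f : A → B}
    (h : ∀ x, f (p x) = q (f x)) (k : ℤ) (x : A) : f ((p ^ k) x) = (q ^ k) (f x) := by
  induction k generalizing x with
  | zero => simp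
  | succ k ih =>
    rw [zpow_add_one, zpow_add_one, Equiv.Perm.mul_apply, Equiv.Perm.mul_apply, ih, h]
  | pred k ih =>
    rw [zpow_sub_one, zpow_sub_one, Equiv.Perm.mul_apply, Equiv.Perm.mul_apply, ih]
    congr 1
    rw [Equiv.Perm.eq_inv_iff_eq, ← h, ← Equiv.Perm.mul_apply, mul_inv_cancel, Equiv.Perm.one_apply]

theorem sameCycle_map_iff {A B : Type*} {p : Equiv.Perm A} {q : Equiv.Perm B} {f : A → B}
    (hf : Function.Injective f) (h : ∀ x, f (p x) = q (f x)) (x y : A) :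
    q.SameCycle (f x) (f y) ↔ p.SameCycle x y := by
  simp only [Equiv.Perm.SameCycle, ← semiconj_zpow h, hf.eq_iff]

open Classical in
/-- The cycle of `p_w` through the block `i`. -/
def cycleSet {n : ℕ} (w : H n) (i : Fin n) : Finset (Fin n) :=
  Finset.univ.filter fun j => (blockPerm w).SameCycle i j

theorem mem_cycleSet {n : ℕ} {w : H n} {i j : Fin n} :
    j ∈ cycleSet w i ↔ (blockPerm w).SameCycle i j := by
  simp [cycleSet]

theorem cycleSet_eq_iff {n : ℕ} {w : H n} {i j : Fin n} :
    cycleSet w i = cycleSet w j ↔ (blockPerm w).SameCycle i j := by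
  constructor
  · intro h
    rw [← mem_cycleSet, h, mem_cycleSet]
  · intro h
    ext k
    rw [mem_cycleSet, mem_cycleSet]
    exact ⟨h.symm.trans, h.trans⟩

theorem mem_blockCycles {n : ℕ} {w : H n} {B : Finset (Fin n)} :
    B ∈ blockCycles w ↔ ∃ i, cycleSet w i = B := by
  simp [blockCycles, cycleSet]

/-- The size of the cycle of `p_w` through `i`, together with the truth value of `Joined w i`. -/
def signature {n : ℕ} (w : H n) (i : Fin n) : ℕ × Prop := ((cycleSet w i).card, Joined w i)

/-- The map `f` may interchange the two points of a block; this is harmless because `SameCycle` is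
symmetric. -/
theorem joined_map_iff {a b : ℕ} {w : H a} {w' : H b} {f : Fin a × Fin 2 → Fin b × Fin 2}
    {φ : Fin a → Fin b} (hf : Function.Injective f) (hfst : ∀ x, (f x).1 = φ x.1)
    (hw : ∀ x, f (w.1 x) = w'.1 (f x)) (i : Fin a) : Joined w' (φ i) ↔ Joined w i := by
  rw [Joined, Joined, ← sameCycle_map_iff hf hw]
  have h0 := hfst (i, 0)
  have h1 := hfst (i, 1)
  have hne : f (i, 0) ≠ f (i, 1) := fun h => by simpa using hf h
  generalize f (i, 0) = u at h0 hne ⊢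
  generalize f (i, 1) = v at h1 hne ⊢
  obtain ⟨u1, u2⟩ := u
  obtain ⟨v1, v2⟩ := v
  obtain rfl : u1 = φ i := h0
  obtain rfl : v1 = φ i := h1
  fin_cases u2 <;> fin_cases v2
  · exact absurd rfl hne
  · rfl
  · exact Equiv.Perm.sameCycle_comm
  · exact absurd rfl hne

theorem blockPerm_map {a b : ℕ} {w : H a} {w' : H b} {f : Fin a × Fin 2 → Fin b × Fin 2}
    {φ : Fin a → Fin b} (hfst : ∀ x, (f x).1 = φ x.1)
    (hw : ∀ x, f (w.1 x) = w'.1 (f x)) (i : Fin a) :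
    φ (blockPerm w i) = blockPerm w' (φ i) := by
  have h := congrArg Prod.fst (hw (i, 0))
  rwa [hfst, fst_apply, fst_apply, hfst] at h

theorem signature_map {a b : ℕ} {w : H a} {w' : H b} {f : Fin a × Fin 2 → Fin b × Fin 2}
    {φ : Fin a → Fin b} (hf : Function.Injective f) (hφ : Function.Injective φ)
    (hfst : ∀ x, (f x).1 = φ x.1)
    (hw : ∀ x, f (w.1 x) = w'.1 (f x)) (i : Fin a) : signature w' (φ i) = signature w i := by
  have hb := blockPerm_map hfst hw
  refine Prod.ext ?_ (propext (joined_map_iff hf hfst hw i))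
  have : cycleSet w' (φ i) = (cycleSet w i).map ⟨φ, hφ⟩ := by
    ext j
    simp only [mem_cycleSet, Finset.mem_map, Function.Embedding.coeFn_mk]
    constructor
    · rintro ⟨k, rfl⟩
      exact ⟨(blockPerm w ^ k) i, ⟨k, rfl⟩, semiconj_zpow hb k i⟩
    · rintro ⟨j, hj, rfl⟩
      exact (sameCycle_map_iff hφ hb i j).2 hj
  simp [signature, this]

theorem signature_blockPerm {n : ℕ} (w : H n) (i : Fin n) :
    signature w (blockPerm w i) = signature w i :=
  signature_map w.1.injective (blockPerm w).injective (fst_apply w) (fun _ => rfl) i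

theorem signature_eq_of_sameCycle {n : ℕ} {w : H n} {i j : Fin n}
    (h : (blockPerm w).SameCycle i j) : signature w i = signature w j := by
  obtain ⟨k, rfl⟩ := h
  have := semiconj_zpow (p := blockPerm w) (q := 1) (signature_blockPerm w) k i
  simpa using this.symm

open Classical in
/-- The number of blocks with a given signature. -/
def signatureCount {n : ℕ} (w : H n) (s : ℕ × Prop) : ℕ :=
  (Finset.univ.filter fun i => signature w i = s).card

-- The signature is constant along a cycle of blocks, and a cycle of length `m` contains `m` blocks.
-- As parts are positive, signature counts therefore determine the type, and types can be compared
-- block by block.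
open Classical in
theorem signatureCount_eq_mul {n : ℕ} (w : H n) (m : ℕ) (J : Prop) :
    signatureCount w (m, J) =
      ((blockCycles w).filter fun B => (∀ i ∈ B, Joined w i = J) ∧ m = B.card).card * m := by
  rw [signatureCount, Finset.card_eq_sum_card_fiberwise (f := cycleSet w)
    (t := (blockCycles w).filter fun B => (∀ i ∈ B, Joined w i = J) ∧ m = B.card)]
  · rw [Finset.sum_const_nat (m := m)]
    intro B hB
    obtain ⟨hB, hJ, hm⟩ := Finset.mem_filter.1 hB
    obtain ⟨i, rfl⟩ := mem_blockCycles.1 hB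
    conv_rhs => rw [hm]
    congr 1
    ext j
    simp only [Finset.mem_filter, Finset.mem_univ, true_and]
    rw [cycleSet_eq_iff, Equiv.Perm.sameCycle_comm, mem_cycleSet]
    refine ⟨And.right, fun h => ⟨?_, h⟩⟩
    rw [← signature_eq_of_sameCycle h]
    exact Prod.ext hm.symm (hJ i (mem_cycleSet.2 (Equiv.Perm.SameCycle.refl _ _)))
  · intro i hi
    have hi' : signature w i = (m, J) := by simpa using hi
    simp only [Finset.coe_filter, Set.mem_ofPred_eq]
    refine ⟨mem_blockCycles.2 ⟨i, rfl⟩, fun j hj => ?_, (congrArg Prod.fst hi').symm⟩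
    rw [signature_eq_of_sameCycle (mem_cycleSet.1 hj)] at hi'
    exact congrArg Prod.snd hi'

theorem signatureCount_false {n : ℕ} (w : H n) (m : ℕ) :
    signatureCount w (m, False) = (type w).1.count m * m := by
  classical
  rw [signatureCount_eq_mul, type, Multiset.count_map, ← Finset.filter_val, Finset.filter_filter,
    Finset.card_val]
  simp

theorem signatureCount_true {n : ℕ} (w : H n) (m : ℕ) :
    signatureCount w (m, True) = (type w).2.count m * m := by
  classical
  rw [signatureCount_eq_mul, type, Multiset.count_map, ← Finset.filter_val, Finset.filter_filter,
    Finset.card_val]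
  simp

theorem card_pos_of_mem_blockCycles {n : ℕ} {w : H n} {B : Finset (Fin n)}
    (hB : B ∈ blockCycles w) : 1 ≤ B.card := by
  obtain ⟨i, rfl⟩ := mem_blockCycles.1 hB
  exact Finset.card_pos.2 ⟨i, mem_cycleSet.2 (Equiv.Perm.SameCycle.refl _ _)⟩

theorem isPartition_type_fst {n : ℕ} (w : H n) : IsPartition (type w).1 := by
  intro m hm
  classical
  simp only [type] at hm
  obtain ⟨B, hB, rfl⟩ := Multiset.mem_map.1 hm
  exact card_pos_of_mem_blockCycles (Finset.mem_filter.1 hB).1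

theorem isPartition_type_snd {n : ℕ} (w : H n) : IsPartition (type w).2 := by
  intro m hm
  classical
  simp only [type] at hm
  obtain ⟨B, hB, rfl⟩ := Multiset.mem_map.1 hm
  exact card_pos_of_mem_blockCycles (Finset.mem_filter.1 hB).1

theorem IsPartition.ext {s t : Multiset ℕ} (hs : IsPartition s) (ht : IsPartition t)
    (h : ∀ m, s.count m * m = t.count m * m) : s = t := by
  ext m
  rcases Nat.eq_zero_or_pos m with rfl | hm
  · rw [Multiset.count_eq_zero_of_notMem fun h0 => absurd (hs 0 h0) (by simp),
      Multiset.count_eq_zero_of_notMem fun h0 => absurd (ht 0 h0) (by simp)]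
  · exact Nat.eq_of_mul_eq_mul_right hm (h m)

theorem type_eq_of_signatureCount {n : ℕ} {w : H n} {M : Multiset ℕ × Multiset ℕ}
    (h1 : IsPartition M.1) (h2 : IsPartition M.2)
    (hf : ∀ m, signatureCount w (m, False) = M.1.count m * m)
    (ht : ∀ m, signatureCount w (m, True) = M.2.count m * m) : type w = M :=
  Prod.ext ((isPartition_type_fst w).ext h1 fun m => (signatureCount_false w m).symm.trans (hf m))
    ((isPartition_type_snd w).ext h2 fun m => (signatureCount_true w m).symm.trans (ht m))

theorem signatureCount_congr {a b : ℕ} {w : H a} {w' : H b} (h : type w = type w') (s : ℕ × Prop) :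
    signatureCount w s = signatureCount w' s := by
  obtain ⟨m, J⟩ := s
  by_cases hJ : J
  · rw [eq_true hJ, signatureCount_true, signatureCount_true, h]
  · rw [eq_false hJ, signatureCount_false, signatureCount_false, h]

theorem type_congr {a b : ℕ} {w : H a} {w' : H b}
    (h : ∀ s, signatureCount w s = signatureCount w' s) : type w = type w' :=
  type_eq_of_signatureCount (isPartition_type_fst w') (isPartition_type_snd w')
    (fun m => (h _).trans (signatureCount_false w' m))
    (fun m => (h _).trans (signatureCount_true w' m))

theorem type_conj {n : ℕ} (g w : H n) : type (g * w * g⁻¹) = type w := by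
  classical
  refine type_congr fun s => ?_
  unfold signatureCount
  symm
  refine Finset.card_bij (fun i _ => blockPerm g i) ?_
    (fun _ _ _ _ h => (blockPerm g).injective h) ?_
  all_goals
    have key : ∀ i, signature (g * w * g⁻¹) (blockPerm g i) = signature w i :=
      signature_map g.1.injective (blockPerm g).injective (fst_apply g) (fun x => by simp)
  · intro i hi
    simpa [key] using hi
  · intro j hj
    obtain ⟨i, rfl⟩ := (blockPerm g).surjective j
    exact ⟨i, by simpa [key] using hj, rfl⟩

-- The cycles partition the blocks, and `Joined` is constant on each, so every cycle contributes to
-- exactly one of the two partitions.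
open Classical in
theorem sum_type {n : ℕ} (w : H n) : (type w).1.sum + (type w).2.sum = n := by
  have h : ∑ B ∈ blockCycles w, B.card = n := by
    conv_rhs => rw [← Finset.card_fin n, Finset.card_eq_sum_card_fiberwise (f := cycleSet w)
      (t := blockCycles w) fun i _ => mem_blockCycles.2 ⟨i, rfl⟩]
    refine Finset.sum_congr rfl fun B hB => ?_
    obtain ⟨i, rfl⟩ := mem_blockCycles.1 hB
    congr 1
    ext j
    simp [cycleSet_eq_iff, mem_cycleSet, Equiv.Perm.sameCycle_comm]
  refine Eq.trans ?_ ((Finset.sum_filter_add_sum_filter_not (blockCycles w)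
    (fun B => ∀ i ∈ B, ¬ Joined w i) Finset.card).trans h)
  suffices e : ((blockCycles w).filter fun B => ∀ i ∈ B, Joined w i) =
      (blockCycles w).filter fun B => ¬ ∀ i ∈ B, ¬ Joined w i by
    rw [← e]
    rfl
  refine Finset.filter_congr fun B hB => ?_
  obtain ⟨i, rfl⟩ := mem_blockCycles.1 hB
  have hJ : ∀ j ∈ cycleSet w i, (Joined w j ↔ Joined w i) := fun j hj =>
    (congrArg Prod.snd (signature_eq_of_sameCycle (mem_cycleSet.1 hj)).symm).to_iff
  have hi : i ∈ cycleSet w i := mem_cycleSet.2 (Equiv.Perm.SameCycle.refl _ _)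
  constructor
  · exact fun h h' => h' i hi (h i hi)
  · intro h
    push Not at h
    obtain ⟨j, hj, hj'⟩ := h
    exact fun k hk => (hJ k hk).2 ((hJ j hj).1 hj')

/-! ### The involution `bar` and conjugacy of elements of equal type -/

theorem mem_H_of_fst {n : ℕ} {w : Equiv.Perm (Fin n × Fin 2)}
    (h : ∀ i, (w (i, 1)).1 = (w (i, 0)).1) : w ∈ H n := by
  intro r
  refine ⟨(w (r, 0)).1, Set.Subset.antisymm ?_ ?_⟩
  · rintro _ ⟨⟨i, b⟩, hi, rfl⟩
    obtain rfl : i = r := hi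
    fin_cases b
    · rfl
    · exact h i
  · intro c hc
    have hc' : c.1 = (w (r, 0)).1 := hc
    have hne : w (r, 0) ≠ w (r, 1) := fun h => by simpa using w.injective h
    suffices c = w (r, 0) ∨ c = w (r, 1) by
      rcases this with rfl | rfl
      · exact ⟨(r, 0), rfl, rfl⟩
      · exact ⟨(r, 1), rfl, rfl⟩
    have h1 := h r
    generalize w (r, 0) = u at *
    generalize w (r, 1) = v at *
    obtain ⟨u1, u2⟩ := u
    obtain ⟨v1, v2⟩ := v
    obtain ⟨c1, c2⟩ := c
    obtain rfl : c1 = u1 := hc'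
    obtain rfl : v1 = c1 := h1
    fin_cases u2 <;> fin_cases v2 <;> fin_cases c2 <;> simp_all

/-- The involution `a ↦ ā` that interchanges the two points of each block. -/
def bar (n : ℕ) : Equiv.Perm (Fin n × Fin 2) :=
  Equiv.prodCongr (Equiv.refl _) (Equiv.swap 0 1)

theorem bar_zpow_apply {n : ℕ} (k : ℤ) (a : Fin n × Fin 2) :
    (bar n ^ k) a = (a.1, (Equiv.swap 0 1 ^ k : Equiv.Perm (Fin 2)) a.2) := by
  refine Prod.ext ?_ ?_
  · simpa using semiconj_zpow (f := Prod.fst) (p := bar n) (q := 1) (fun _ => rfl) k a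
  · exact semiconj_zpow (f := Prod.snd) (p := bar n) (fun _ => rfl) k a

theorem fixes_fin_two (p : Equiv.Perm (Fin 2)) (b c : Fin 2) : p b = b ↔ p c = c := by
  revert p b c
  decide

theorem bar_zpow_apply_eq_self_iff {m n : ℕ} (k : ℤ) (a : Fin m × Fin 2) (b : Fin n × Fin 2) :
    (bar m ^ k) a = a ↔ (bar n ^ k) b = b := by
  simp only [bar_zpow_apply, Prod.ext_iff, true_and]
  exact fixes_fin_two _ _ _

theorem eq_or_eq_bar {n : ℕ} {a b : Fin n × Fin 2} (h : a.1 = b.1) : a = b ∨ a = bar n b := by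
  obtain ⟨a1, a2⟩ := a
  obtain ⟨b1, b2⟩ := b
  obtain rfl : a1 = b1 := h
  fin_cases a2 <;> fin_cases b2 <;> simp [bar]

theorem bar_ne {n : ℕ} (a : Fin n × Fin 2) : bar n a ≠ a := by
  obtain ⟨a1, a2⟩ := a
  fin_cases a2 <;> simp [bar]

theorem apply_bar {n : ℕ} (w : H n) (a : Fin n × Fin 2) : w.1 (bar n a) = bar n (w.1 a) := by
  refine (eq_or_eq_bar (fst_apply_eq w (a := bar n a) (b := a) rfl)).resolve_left fun h => ?_
  exact bar_ne a (w.1.injective h)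

theorem commute_bar {n : ℕ} (w : H n) : Commute w.1 (bar n) :=
  Equiv.ext fun a => apply_bar w a

theorem mem_H_of_commute_bar {n : ℕ} {w : Equiv.Perm (Fin n × Fin 2)}
    (h : ∀ a, w (bar n a) = bar n (w a)) : w ∈ H n := by
  refine mem_H_of_fst fun i => ?_
  have := congrArg Prod.fst (h (i, 0))
  simpa [bar] using this

theorem joined_iff {n : ℕ} (w : H n) (a : Fin n × Fin 2) :
    Joined w a.1 ↔ w.1.SameCycle a (bar n a) := by
  obtain ⟨i, b⟩ := a
  fin_cases b
  · simp [Joined, bar]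
  · simp [Joined, bar, Equiv.Perm.sameCycle_comm]

theorem zpow_apply_eq_self_iff_card_dvd {n : ℕ} (w : H n) (i : Fin n) (k : ℤ) :
    (blockPerm w ^ k) i = i ↔ ((cycleSet w i).card : ℤ) ∣ k := by
  classical
  have h := MulAction.zpow_smul_eq_iff_minimalPeriod_dvd (a := blockPerm w) (b := i) (n := k)
  rw [← Equiv.Perm.smul_def, h, MulAction.minimalPeriod_eq_card, ← Set.toFinset_card]
  have e : (MulAction.orbit (Subgroup.zpowers (blockPerm w)) i).toFinset = cycleSet w i := by
    ext j
    rw [Set.mem_toFinset, mem_cycleSet]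
    constructor
    · rintro ⟨⟨_, k, rfl⟩, rfl⟩
      exact ⟨k, rfl⟩
    · rintro ⟨k, rfl⟩
      exact ⟨⟨_, k, rfl⟩, rfl⟩
  rw [e]

-- The first return of `a` to its block is `a` or `bar n a`. If it is `a`, every later return is `a`
-- too, so `bar n a` lies in another cycle.
open Classical in
theorem zpow_card_apply {n : ℕ} (w : H n) (a : Fin n × Fin 2) :
    (w.1 ^ ((cycleSet w a.1).card : ℤ)) a = (bar n ^ (if Joined w a.1 then (1 : ℤ) else 0)) a := by
  set m : ℤ := ((cycleSet w a.1).card : ℤ)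
  have hfst : ((w.1 ^ m) a).1 = a.1 := by
    rw [fst_zpow_apply, (zpow_apply_eq_self_iff_card_dvd w a.1 m).2 dvd_rfl]
  split_ifs with hJ
  · rw [zpow_one]
    refine (eq_or_eq_bar hfst).resolve_left fun h => ?_
    obtain ⟨k, hk⟩ := (joined_iff w a).1 hJ
    have hd : m ∣ k := by
      rw [← zpow_apply_eq_self_iff_card_dvd, ← fst_zpow_apply, hk]
      rfl
    obtain ⟨q, rfl⟩ := hd
    rw [zpow_mul, Equiv.Perm.zpow_apply_eq_self_of_apply_eq_self h] at hk
    exact bar_ne a hk.symm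
  · rw [zpow_zero]
    refine (eq_or_eq_bar hfst).resolve_right fun h => hJ ?_
    exact (joined_iff w a).2 ⟨m, h⟩

-- This describes the stabilizer of a point under the commuting actions of `w` and `bar n`. It
-- depends only on the signature of the block, which is what conjugacy needs.
open Classical in
theorem zpow_mul_bar_zpow_fix_iff {n : ℕ} (w : H n) (a : Fin n × Fin 2) (k l : ℤ) :
    (w.1 ^ k * bar n ^ l) a = a ↔ ∃ q : ℤ, k = (cycleSet w a.1).card * q ∧
      (bar n ^ ((if Joined w a.1 then (1 : ℤ) else 0) * q + l)) a = a := by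
  have key : ∀ q : ℤ, (w.1 ^ (((cycleSet w a.1).card : ℤ) * q) * bar n ^ l) a =
      (bar n ^ ((if Joined w a.1 then (1 : ℤ) else 0) * q + l)) a := by
    intro q
    have hc : ∀ r s : ℤ, Commute (w.1 ^ r) (bar n ^ s) := fun r s =>
      (commute_bar w).zpow_zpow r s
    set m : ℤ := ((cycleSet w a.1).card : ℤ)
    set e : ℤ := if Joined w a.1 then (1 : ℤ) else 0
    have h1 : ((bar n ^ (-e)) * w.1 ^ m) a = a := by
      rw [Equiv.Perm.mul_apply, zpow_card_apply, ← Equiv.Perm.mul_apply, ← zpow_add]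
      simp [e]
    have h2 := Equiv.Perm.zpow_apply_eq_self_of_apply_eq_self h1 q
    rw [(hc m (-e)).symm.mul_zpow, ← zpow_mul, ← zpow_mul] at h2
    rw [(hc _ _).eq]
    calc (bar n ^ l * w.1 ^ (m * q)) a
        = (bar n ^ (e * q + l)) ((bar n ^ (-e * q) * w.1 ^ (m * q)) a) := by
          rw [← Equiv.Perm.mul_apply, ← mul_assoc, ← zpow_add]
          congr 3
          ring
      _ = _ := by rw [h2]
  constructor
  · intro h
    have hd : ((cycleSet w a.1).card : ℤ) ∣ k := by
      rw [← zpow_apply_eq_self_iff_card_dvd]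
      have := congrArg Prod.fst h
      rwa [Equiv.Perm.mul_apply, fst_zpow_apply, bar_zpow_apply] at this
    obtain ⟨q, rfl⟩ := hd
    exact ⟨q, rfl, by rw [← key, h]⟩
  · rintro ⟨q, rfl, h⟩
    rw [key, h]

theorem zpow_mul_bar_zpow_fix_congr {m n : ℕ} {w : H m} {w' : H n} {a : Fin m × Fin 2}
    {b : Fin n × Fin 2} (h : signature w a.1 = signature w' b.1) (k l : ℤ) :
    (w.1 ^ k * bar m ^ l) a = a ↔ (w'.1 ^ k * bar n ^ l) b = b := by
  classical
  rw [zpow_mul_bar_zpow_fix_iff, zpow_mul_bar_zpow_fix_iff]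
  simp only [signature, Prod.mk.injEq] at h
  rw [h.1, h.2]
  simp only [bar_zpow_apply_eq_self_iff _ a b]

/-- Here `r` picks a representative of each orbit and `s` its partner in `Y`. Sending `g • r x` to
`g • s x` is well defined and injective on an orbit because stabilizers agree; `hs` keeps different
orbits apart, and equal cardinality gives surjectivity. -/
theorem exists_equivariant_equiv {A X Y : Type*} [Group A] [Finite X] [Finite Y]
    (hcard : Nat.card X = Nat.card Y) (ρ : A →* Equiv.Perm X) (ρ' : A →* Equiv.Perm Y)
    (r : X → X) (s : X → Y) (hr : ∀ x, ∃ g, ρ g (r x) = x) (hrg : ∀ g x, r (ρ g x) = r x)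
    (hsg : ∀ g x, s (ρ g x) = s x)
    (hstab : ∀ x g, ρ g (r x) = r x ↔ ρ' g (s x) = s x)
    (hs : ∀ x y g, ρ' g (s x) = s y → r x = r y) :
    ∃ e : X ≃ Y, ∀ g x, e (ρ g x) = ρ' g (e x) := by
  choose g hg using hr
  have hsr : ∀ x y, r x = r y → s x = s y := by
    have hs' : ∀ x, s (r x) = s x := fun x => by rw [← hsg (g x) (r x), hg]
    intro x y h
    rw [← hs' x, h, hs']
  have hinj : Function.Injective fun x => ρ' (g x) (s x) := by
    intro x y h
    have h1 : ρ' ((g y)⁻¹ * g x) (s x) = s y := by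
      rw [map_mul, Equiv.Perm.mul_apply, map_inv, Equiv.Perm.inv_eq_iff_eq]
      exact h
    have h2 := hs x y _ h1
    rw [← hsr x y h2, ← hstab, map_mul, Equiv.Perm.mul_apply, hg, map_inv,
      Equiv.Perm.inv_eq_iff_eq, h2, hg] at h1
    exact h1
  have hbij : Function.Bijective fun x => ρ' (g x) (s x) :=
    hinj.bijective_of_nat_card_le hcard.ge
  refine ⟨Equiv.ofBijective _ hbij, fun k x => ?_⟩
  simp only [Equiv.ofBijective_apply]
  have h1 : ρ ((k * g x)⁻¹ * g (ρ k x)) (r x) = r x := by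
    rw [map_mul, Equiv.Perm.mul_apply, map_inv, Equiv.Perm.inv_eq_iff_eq, map_mul,
      Equiv.Perm.mul_apply, hg]
    conv_lhs => rw [← hrg k x, hg]
  rw [hstab, map_mul, Equiv.Perm.mul_apply, map_inv, Equiv.Perm.inv_eq_iff_eq, map_mul,
      Equiv.Perm.mul_apply] at h1
  rw [hsg, h1]

open Classical in
theorem card_blockCycles_signature {n : ℕ} (w : H n) (r : {B // B ∈ blockCycles w} → Fin n)
    (hr : ∀ B, cycleSet w (r B) = B.1) (m : ℕ) (J : Prop) :
    Fintype.card {B // signature w (r B) = (m, J)} * m = signatureCount w (m, J) := by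
  rw [signatureCount_eq_mul, Fintype.card_subtype]
  congr 1
  refine Finset.card_bij (fun B _ => B.1) ?_ (fun _ _ _ _ h => Subtype.ext h) ?_
  · intro B hB
    simp only [Finset.mem_filter, Finset.mem_univ, true_and, signature, Prod.mk.injEq, hr] at hB ⊢
    refine ⟨B.2, fun i hi => ?_, hB.1.symm⟩
    rw [← hr, mem_cycleSet] at hi
    rw [← hB.2]
    exact (congrArg Prod.snd (signature_eq_of_sameCycle hi)).symm
  · intro B hB
    simp only [Finset.mem_filter] at hB
    refine ⟨⟨B, hB.1⟩, ?_, rfl⟩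
    simp only [Finset.mem_filter, Finset.mem_univ, true_and, signature, Prod.mk.injEq, hr]
    refine ⟨hB.2.2.symm, hB.2.1 _ ?_⟩
    exact (hr ⟨B, hB.1⟩).le (mem_cycleSet.2 (Equiv.Perm.SameCycle.refl _ _))

/-- Equal types give equally many cycles of each signature, hence a signature-preserving bijection
of cycles. The maps `r` and `t` send a block to a chosen block of its own cycle and of the matched
cycle. -/
theorem exists_cycle_matching {m n : ℕ} {w : H m} {w' : H n} (h : type w = type w') :
    ∃ (r : Fin m → Fin m) (t : Fin m → Fin n),
      (∀ i, (blockPerm w).SameCycle (r i) i) ∧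
      (∀ i j, (blockPerm w).SameCycle i j → r i = r j ∧ t i = t j) ∧
      (∀ i, signature w i = signature w' (t i)) ∧
      ∀ i j, (blockPerm w').SameCycle (t i) (t j) → r i = r j := by
  classical
  have hex : ∀ {k : ℕ} (u : H k), ∃ r : {B // B ∈ blockCycles u} → Fin k,
      ∀ B, cycleSet u (r B) = B.1 := fun u =>
    Classical.axiom_of_choice (r := fun (B : {B // B ∈ blockCycles u}) i => cycleSet u i = B.1)
      fun B => mem_blockCycles.1 B.2
  obtain ⟨r, hr⟩ := hex w
  obtain ⟨r', hr'⟩ := hex w'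
  have hcard : ∀ s, Nonempty ({B // signature w (r B) = s} ≃ {B // signature w' (r' B) = s}) := by
    rintro ⟨k, J⟩
    refine ⟨Fintype.equivOfCardEq ?_⟩
    -- Signature counts give the number of cycles only after multiplication by the length `k`. For
    -- `k = 0` there are no cycles at all.
    rcases Nat.eq_zero_or_pos k with rfl | hk
    · rw [Fintype.card_eq_zero_iff.2, Fintype.card_eq_zero_iff.2]
      · refine ⟨fun B => ?_⟩
        have h1 := congrArg Prod.fst B.2
        simp only [signature, hr'] at h1
        exact absurd (card_pos_of_mem_blockCycles B.1.2) (by omega)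
      · refine ⟨fun B => ?_⟩
        have h1 := congrArg Prod.fst B.2
        simp only [signature, hr] at h1
        exact absurd (card_pos_of_mem_blockCycles B.1.2) (by omega)
    · refine Nat.eq_of_mul_eq_mul_right hk ?_
      rw [card_blockCycles_signature w r hr, card_blockCycles_signature w' r' hr',
        signatureCount_congr h]
  obtain ⟨σ, hσ⟩ : ∃ σ : {B // B ∈ blockCycles w} ≃ {B // B ∈ blockCycles w'},
      ∀ B, signature w' (r' (σ B)) = signature w (r B) :=
    ⟨_, fun B => Equiv.ofFiberEquiv_map (f := fun B => signature w (r B))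
      (g := fun B => signature w' (r' B)) (fun s => (hcard s).some) B⟩
  let c : Fin m → {B // B ∈ blockCycles w} := fun i => ⟨cycleSet w i, mem_blockCycles.2 ⟨i, rfl⟩⟩
  have hc : ∀ {i j}, (blockPerm w).SameCycle i j → c i = c j := fun h =>
    Subtype.ext (cycleSet_eq_iff.2 h)
  have hrc : ∀ i, (blockPerm w).SameCycle (r (c i)) i := fun i => cycleSet_eq_iff.1 (hr (c i))
  refine ⟨fun i => r (c i), fun i => r' (σ (c i)), hrc, ?_, ?_, ?_⟩
  · intro i j hij
    simp only [hc hij, and_self]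
  · intro i
    rw [hσ, signature_eq_of_sameCycle (hrc i)]
  · intro i j hij
    rw [← cycleSet_eq_iff, hr', hr'] at hij
    have := σ.injective (Subtype.ext hij)
    simp only [this]

/-- The action of `ℤ × ℤ` on the points for which the first generator acts as `w` and the second
one as `a ↦ ā`. -/
def barAction {n : ℕ} (w : H n) :
    Multiplicative ℤ × Multiplicative ℤ →* Equiv.Perm (Fin n × Fin 2) :=
  (zpowersHom _ w.1).noncommCoprod (zpowersHom _ (bar n)) fun k l =>
    (commute_bar w).zpow_zpow k.toAdd l.toAdd

theorem barAction_apply {n : ℕ} (w : H n) (g : Multiplicative ℤ × Multiplicative ℤ) :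
    barAction w g = w.1 ^ g.1.toAdd * bar n ^ g.2.toAdd := rfl

theorem fst_barAction_apply {n : ℕ} (w : H n) (g : Multiplicative ℤ × Multiplicative ℤ)
    (a : Fin n × Fin 2) : (barAction w g a).1 = (blockPerm w ^ g.1.toAdd) a.1 := by
  rw [barAction_apply, Equiv.Perm.mul_apply, fst_zpow_apply, bar_zpow_apply]

/-- An isomorphism of the two `ℤ × ℤ`-sets commutes with `bar n`, hence lies in `H n`, and
intertwines `w` with `w'`. -/
theorem exists_conj_of_type_eq {n : ℕ} {w w' : H n} (h : type w = type w') :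
    ∃ g : H n, g * w * g⁻¹ = w' := by
  obtain ⟨r, t, hr, hrt, hsig, ht⟩ := exists_cycle_matching h
  obtain ⟨e, he⟩ := exists_equivariant_equiv rfl (barAction w) (barAction w')
    (fun a => (r a.1, 0)) (fun a => (t a.1, 0))
    (by
      intro a
      obtain ⟨k, hk⟩ := hr a.1
      -- A power of `w` reaches the block of `a`; one application of `bar n` corrects the point if
      -- necessary.
      rcases eq_or_eq_bar (a := a) (b := (w.1 ^ k) (r a.1, 0))
        (by rw [fst_zpow_apply, hk]) with h1 | h1
      · exact ⟨(Multiplicative.ofAdd k, 1), by simp [barAction_apply, ← h1]⟩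
      · refine ⟨(Multiplicative.ofAdd k, Multiplicative.ofAdd 1), ?_⟩
        rw [barAction_apply, ((commute_bar w).zpow_zpow _ _).eq]
        simp [← h1])
    (by
      intro g a
      simp only [Prod.mk.injEq, and_true]
      rw [fst_barAction_apply]
      exact (hrt _ _ ⟨g.1.toAdd, rfl⟩).1.symm)
    (by
      intro g a
      simp only [Prod.mk.injEq, and_true]
      rw [fst_barAction_apply]
      exact (hrt _ _ ⟨g.1.toAdd, rfl⟩).2.symm)
    (by
      intro a g
      refine zpow_mul_bar_zpow_fix_congr ?_ _ _
      rw [← hsig, signature_eq_of_sameCycle (hr _)])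
    (by
      intro a b g hg
      have h1 := congrArg Prod.fst hg
      rw [fst_barAction_apply] at h1
      simp only [Prod.mk.injEq, and_true]
      exact ht _ _ ⟨_, h1⟩)
  have hw : ∀ a, e (w.1 a) = w'.1 (e a) := fun a => by
    simpa [barAction_apply] using he (Multiplicative.ofAdd 1, 1) a
  have hb : ∀ a, e (bar n a) = bar n (e a) := fun a => by
    simpa [barAction_apply] using he (1, Multiplicative.ofAdd 1) a
  refine ⟨⟨e, mem_H_of_commute_bar hb⟩, ?_⟩
  rw [mul_inv_eq_iff_eq_mul]
  exact Subtype.ext (Equiv.ext hw)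

/-! ### Extension by the identity along an embedding of blocks -/

/-- The embedding of points induced by an embedding of blocks. -/
def pointEmbedding {a b : ℕ} (φ : Fin a ↪ Fin b) : Fin a × Fin 2 ↪ Fin b × Fin 2 :=
  φ.prodMap (Function.Embedding.refl _)

theorem viaEmbedding_mem_H {a b : ℕ} (φ : Fin a ↪ Fin b) (w : H a) :
    w.1.viaEmbedding (pointEmbedding φ) ∈ H b := by
  refine mem_H_of_fst fun i => ?_
  by_cases hi : ∃ j, φ j = i
  · obtain ⟨j, rfl⟩ := hi
    have h : ∀ c, (w.1.viaEmbedding (pointEmbedding φ) (φ j, c)).1 = φ (blockPerm w j) := by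
      intro c
      rw [show (φ j, c) = pointEmbedding φ (j, c) from rfl, Equiv.Perm.viaEmbedding_apply,
        ← fst_apply w (j, c)]
      rfl
    rw [h, h]
  · have h : ∀ c, w.1.viaEmbedding (pointEmbedding φ) (i, c) = (i, c) := by
      intro c
      refine Equiv.Perm.viaEmbedding_apply_of_notMem _ _ _ ?_
      rintro ⟨⟨j, d⟩, hj⟩
      exact hi ⟨j, congrArg Prod.fst hj⟩
    rw [h, h]

/-- Extension of the elements of `H a` by the identity, along an embedding of the blocks. -/
def extend {a b : ℕ} (φ : Fin a ↪ Fin b) : H a →* H b :=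
  ((Equiv.Perm.viaEmbeddingHom (pointEmbedding φ)).comp (H a).subtype).codRestrict (H b)
    fun w => viaEmbedding_mem_H φ w

theorem extend_apply {a b : ℕ} (φ : Fin a ↪ Fin b) (w : H a) (x : Fin a × Fin 2) :
    (extend φ w).1 (pointEmbedding φ x) = pointEmbedding φ (w.1 x) :=
  Equiv.Perm.viaEmbedding_apply _ _ _

theorem extend_apply_of_notMem {a b : ℕ} (φ : Fin a ↪ Fin b) (w : H a) (x : Fin b × Fin 2)
    (hx : x.1 ∉ Set.range φ) : (extend φ w).1 x = x := by
  refine Equiv.Perm.viaEmbedding_apply_of_notMem _ _ _ ?_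
  rintro ⟨y, rfl⟩
  exact hx ⟨y.1, rfl⟩

theorem extend_injective {a b : ℕ} (φ : Fin a ↪ Fin b) : Function.Injective (extend φ) := by
  intro u v h
  refine Subtype.ext (Equiv.ext fun x => (pointEmbedding φ).injective ?_)
  rw [← extend_apply, ← extend_apply, h]

theorem signature_extend {a b : ℕ} (φ : Fin a ↪ Fin b) (w : H a) (i : Fin a) :
    signature (extend φ w) (φ i) = signature w i :=
  signature_map (pointEmbedding φ).injective φ.injective (fun _ => rfl)
    (fun x => (extend_apply φ w x).symm) i

/-- `w` fixes both points of the block `i`. -/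
def Fixes {n : ℕ} (w : H n) (i : Fin n) : Prop := ∀ b, w.1 (i, b) = (i, b)

theorem signature_eq_one_iff {n : ℕ} (w : H n) (i : Fin n) :
    signature w i = (1, False) ↔ Fixes w i := by
  classical
  constructor
  · intro h b
    have hc : (cycleSet w i).card = 1 := congrArg Prod.fst h
    have hJ : ¬ Joined w i := (congrArg Prod.snd h).le
    have := zpow_card_apply w (i, b)
    rwa [if_neg hJ, zpow_zero, hc, Nat.cast_one, zpow_one] at this
  · intro h
    have hz : ∀ b (k : ℤ), (w.1 ^ k) (i, b) = (i, b) := fun b k =>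
      Equiv.Perm.zpow_apply_eq_self_of_apply_eq_self (h b) k
    refine Prod.ext ?_ (eq_false ?_)
    · change (cycleSet w i).card = 1
      refine Finset.card_eq_one.2 ⟨i, ?_⟩
      ext j
      rw [mem_cycleSet, Finset.mem_singleton]
      constructor
      · rintro ⟨k, rfl⟩
        rw [← fst_zpow_apply w k (i, 0), hz]
      · rintro rfl
        exact Equiv.Perm.SameCycle.refl _ _
    · rintro ⟨k, hk⟩
      rw [hz] at hk
      simp at hk

theorem fixes_extend_of_notMem {a b : ℕ} (φ : Fin a ↪ Fin b) (w : H a) (i : Fin b)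
    (hi : i ∉ Set.range φ) : Fixes (extend φ w) i :=
  fun c => extend_apply_of_notMem φ w (i, c) hi

theorem fixes_extend_iff {a b : ℕ} (φ : Fin a ↪ Fin b) (w : H a) (i : Fin a) :
    Fixes (extend φ w) (φ i) ↔ Fixes w i := by
  rw [← signature_eq_one_iff, signature_extend, signature_eq_one_iff]

theorem exists_extend_eq {a b : ℕ} (φ : Fin a ↪ Fin b) (w : H b)
    (h : ∀ i, i ∉ Set.range φ → Fixes w i) : ∃ v, extend φ v = w := by
  have hmem : ∀ u : H b, (∀ i, i ∉ Set.range φ → Fixes u i) → ∀ x, ∃ y,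
      pointEmbedding φ y = u.1 (pointEmbedding φ x) := by
    intro u hu x
    by_contra hx
    have hn : (u.1 (pointEmbedding φ x)).1 ∉ Set.range φ := by
      rintro ⟨j, hj⟩
      exact hx ⟨(j, (u.1 (pointEmbedding φ x)).2), Prod.ext hj rfl⟩
    -- A point sent outside the range would have the same image as that image point, which is fixed;
    -- injectivity excludes this.
    have := hu _ hn (u.1 (pointEmbedding φ x)).2
    rw [Prod.mk.eta] at this
    exact hx ⟨x, (u.1.injective this).symm⟩
  have h' : ∀ i, i ∉ Set.range φ → Fixes w⁻¹ i := by
    intro i hi c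
    change w.1⁻¹ (i, c) = (i, c)
    rw [Equiv.Perm.inv_eq_iff_eq]
    exact (h i hi c).symm
  choose f hf using hmem w h
  choose g hg using hmem w⁻¹ h'
  have hww : ∀ x, w.1 ((w⁻¹).1 x) = x := fun x => by simp
  have hww' : ∀ x, (w⁻¹).1 (w.1 x) = x := fun x => by simp
  let v : Equiv.Perm (Fin a × Fin 2) :=
    ⟨f, g, fun x => (pointEmbedding φ).injective (by rw [hg, hf, hww']),
      fun x => (pointEmbedding φ).injective (by rw [hf, hg, hww])⟩
  have hv : v ∈ H a := by
    refine mem_H_of_fst fun i => φ.injective ?_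
    have h0 : ∀ c, φ (v (i, c)).1 = (w.1 (φ i, c)).1 := fun c => congrArg Prod.fst (hf (i, c))
    rw [h0, h0]
    exact fst_apply_eq w rfl
  refine ⟨⟨v, hv⟩, Subtype.ext (Equiv.ext ?_)⟩
  rintro ⟨i, c⟩
  by_cases hi : i ∈ Set.range φ
  · obtain ⟨j, rfl⟩ := hi
    exact (extend_apply φ _ (j, c)).trans (hf (j, c))
  · rw [extend_apply_of_notMem φ _ (i, c) hi]
    exact (h i hi c).symm

open Classical in
theorem signatureCount_extend {a b : ℕ} (φ : Fin a ↪ Fin b) (w : H a) (s : ℕ × Prop) :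
    signatureCount (extend φ w) s = signatureCount w s + if s = (1, False) then b - a else 0 := by
  have h := Finset.card_filter_add_card_filter_not
    (s := Finset.univ.filter fun i => signature (extend φ w) i = s) (fun i => i ∈ Set.range φ)
  rw [Finset.filter_filter, Finset.filter_filter] at h
  rw [signatureCount, ← h]
  congr 1
  · rw [signatureCount, ← Finset.card_map φ]
    congr 1
    ext i
    simp only [Finset.mem_filter, Finset.mem_univ, true_and, Finset.mem_map]
    constructor
    · rintro ⟨hs, j, rfl⟩
      exact ⟨j, by rwa [signature_extend] at hs, rfl⟩
    · rintro ⟨j, hs, rfl⟩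
      exact ⟨by rwa [signature_extend], j, rfl⟩
  · have hf : ∀ i, i ∉ Set.range φ → signature (extend φ w) i = (1, False) := fun i hi =>
      (signature_eq_one_iff _ _).2 (fixes_extend_of_notMem φ w i hi)
    split_ifs with hs
    · have : (Finset.univ.filter fun i => signature (extend φ w) i = s ∧ i ∉ Set.range φ) =
          (Finset.univ.map φ)ᶜ := by
        ext i
        simp only [Finset.mem_filter, Finset.mem_univ, true_and, Finset.mem_compl,
          Finset.mem_map]
        exact ⟨fun h => h.2, fun h => ⟨(hf i h).trans hs.symm, h⟩⟩
      rw [this, Finset.card_compl, Finset.card_map]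
      simp
    · rw [Finset.card_eq_zero, Finset.filter_eq_empty_iff]
      rintro i - ⟨h1, h2⟩
      exact hs (h1.symm.trans (hf i h2))

theorem IsPartition.add {s t : Multiset ℕ} (hs : IsPartition s) (ht : IsPartition t) :
    IsPartition (s + t) := fun m hm => (Multiset.mem_add.1 hm).elim (hs m) (ht m)

theorem type_extend {a b : ℕ} (φ : Fin a ↪ Fin b) (w : H a) :
    type (extend φ w) = ((type w).1 + Multiset.replicate (b - a) 1, (type w).2) := by
  refine type_eq_of_signatureCount ?_ (isPartition_type_snd w) ?_ ?_
  · exact (isPartition_type_fst w).add fun m hm => (Multiset.eq_of_mem_replicate hm).ge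
  · intro m
    rw [signatureCount_extend, signatureCount_false, Multiset.count_add,
      Multiset.count_replicate, add_mul]
    by_cases hm : m = 1
    · simp [hm]
    · simp [hm, Ne.symm hm]
  · intro m
    rw [signatureCount_extend, signatureCount_true]
    simp

theorem ProperPair.size_le_of_type_eq {n : ℕ} {w : H n} {x : ProperPair}
    (h : type w = x.complete n) : x.size ≤ n := by
  have h1 := sum_type w
  rw [h, ProperPair.complete, Multiset.sum_add] at h1
  change x.lam.sum + _ + x.del.sum = n at h1
  unfold ProperPair.size
  omega

theorem ProperPair.count_one_complete (x : ProperPair) (n : ℕ) :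
    (x.complete n).1.count 1 = n - x.size := by
  rw [ProperPair.complete, Multiset.count_add, Multiset.count_eq_zero_of_notMem x.proper,
    Multiset.count_replicate_self, zero_add]

/-- Extension adds `b - a` parts `1`, exactly as completion does. This makes the classes for
different `n` compatible. -/
theorem type_extend_eq_complete_iff {a b : ℕ} (φ : Fin a ↪ Fin b) (w : H a) (x : ProperPair)
    (hx : x.size ≤ b) : type (extend φ w) = x.complete b ↔ type w = x.complete a := by
  have hab : a ≤ b := by simpa using Fintype.card_le_of_embedding φ
  by_cases ha : x.size ≤ a
  · rw [type_extend, ProperPair.complete, ProperPair.complete, Prod.ext_iff, Prod.ext_iff,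
      show b - x.size = (a - x.size) + (b - a) by omega, Multiset.replicate_add, ← add_assoc]
    simp only [add_left_inj]
  -- When `a < x.size`, the extension has at least `b - a` parts `1`, more than the `b - x.size` of
  -- the completed type.
  · refine iff_of_false (fun h => ha ?_) fun h => ha (ProperPair.size_le_of_type_eq h)
    have h1 := x.count_one_complete b
    rw [← h, type_extend, Multiset.count_add, Multiset.count_replicate_self] at h1
    omega

-- Since `x.lam` has no part `1`, the parts `1` of the completed first partition are all padding;
-- they count the pointwise fixed blocks.
open Classical in
theorem card_not_fixes {n : ℕ} (w : H n) (x : ProperPair)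
    (hw : type w = x.complete n) : (Finset.univ.filter fun i => ¬ Fixes w i).card = x.size := by
  have h1 := signatureCount_false w 1
  rw [hw, x.count_one_complete, signatureCount] at h1
  simp only [signature_eq_one_iff] at h1
  have h2 := Finset.card_filter_add_card_filter_not (s := (Finset.univ : Finset (Fin n)))
    (fun i => Fixes w i)
  rw [h1, Finset.card_univ, Fintype.card_fin] at h2
  have hx := ProperPair.size_le_of_type_eq hw
  omega

/-! ### Existence of elements of every type -/

theorem exists_type_add {a b : ℕ} (u : H a) (v : H b) :
    ∃ w : H (a + b), type w = type u + type v := by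
  classical
  let φ : Fin a ↪ Fin (a + b) := Fin.castAddEmb b
  let ψ : Fin b ↪ Fin (a + b) := Fin.natAddEmb a
  have hne : ∀ i j, φ i ≠ ψ j := fun i j h => by
    have := congrArg Fin.val h
    simp only [φ, ψ, Fin.castAddEmb_apply, Fin.natAddEmb_apply, Fin.val_castAdd,
      Fin.val_natAdd] at this
    omega
  let w := extend φ u * extend ψ v
  have h1 : ∀ i, signature w (φ i) = signature u i :=
    signature_map (pointEmbedding φ).injective φ.injective (fun _ => rfl) fun x => by
      change _ = (extend φ u).1 ((extend ψ v).1 _)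
      rw [extend_apply_of_notMem ψ, extend_apply]
      rintro ⟨j, hj⟩
      exact hne _ _ hj.symm
  have h2 : ∀ i, signature w (ψ i) = signature v i :=
    signature_map (pointEmbedding ψ).injective ψ.injective (fun _ => rfl) fun x => by
      change _ = (extend φ u).1 ((extend ψ v).1 _)
      rw [extend_apply, extend_apply_of_notMem φ]
      rintro ⟨j, hj⟩
      exact hne _ _ hj
  have hc : ∀ s, signatureCount w s = signatureCount u s + signatureCount v s := by
    intro s
    simp only [signatureCount, Finset.card_filter]
    rw [Fin.sum_univ_add]
    congr 1
    · exact Finset.sum_congr rfl fun i _ => by rw [← h1]; rfl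
    · exact Finset.sum_congr rfl fun i _ => by rw [← h2]; rfl
  refine ⟨w, type_eq_of_signatureCount ?_ ?_ ?_ ?_⟩
  · exact (isPartition_type_fst u).add (isPartition_type_fst v)
  · exact (isPartition_type_snd u).add (isPartition_type_snd v)
  · intro m
    rw [hc, signatureCount_false, signatureCount_false, Prod.fst_add, Multiset.count_add, add_mul]
  · intro m
    rw [hc, signatureCount_true, signatureCount_true, Prod.snd_add, Multiset.count_add, add_mul]

/-- The cyclic shift of `k + 1` blocks, with `c` applied to the points of the last block. -/
def twistedRotation (k : ℕ) (c : Equiv.Perm (Fin 2)) : H (k + 1) :=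
  ⟨Equiv.prodShear (finRotate (k + 1)) fun i => if i = Fin.last k then c else 1,
    mem_H_of_fst fun _ => rfl⟩

theorem twistedRotation_castSucc {k : ℕ} (c : Equiv.Perm (Fin 2)) (i : Fin k) (b : Fin 2) :
    (twistedRotation k c).1 (i.castSucc, b) = (i.succ, b) := by
  simp [twistedRotation, Equiv.prodShear, (Fin.castSucc_lt_last i).ne]

theorem twistedRotation_last {k : ℕ} (c : Equiv.Perm (Fin 2)) (b : Fin 2) :
    (twistedRotation k c).1 (Fin.last k, b) = (0, c b) := by
  simp [twistedRotation, Equiv.prodShear]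

theorem sameCycle_twistedRotation {k : ℕ} (c : Equiv.Perm (Fin 2)) (i : Fin (k + 1)) (b : Fin 2) :
    (twistedRotation k c).1.SameCycle (0, b) (i, b) := by
  induction i using Fin.induction with
  | zero => exact Equiv.Perm.SameCycle.refl _ _
  | succ i ih =>
    rw [← twistedRotation_castSucc c, Equiv.Perm.sameCycle_apply_right]
    exact ih

/-- The blocks form one cycle, and going round once applies `c`. The two points of a block are
joined exactly when `c` is the transposition; for `c = 1` the second coordinate is invariant. -/
theorem signature_twistedRotation {k : ℕ} (c : Equiv.Perm (Fin 2)) (i : Fin (k + 1)) :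
    signature (twistedRotation k c) i = (k + 1, c 0 = 1) := by
  have hs : ∀ j, (blockPerm (twistedRotation k c)).SameCycle 0 j := fun j => by
    obtain ⟨l, hl⟩ := sameCycle_twistedRotation c j 0
    exact ⟨l, by rw [← fst_zpow_apply _ l (0, 0), hl]⟩
  rw [← signature_eq_of_sameCycle (hs i)]
  refine Prod.ext ?_ (propext ⟨?_, ?_⟩)
  · change (cycleSet _ _).card = _
    rw [Finset.card_eq_of_equiv_fin]
    rw [show cycleSet (twistedRotation k c) 0 = Finset.univ by
      ext j
      simp [mem_cycleSet, hs]]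
    exact (Equiv.subtypeUnivEquiv fun x => Finset.mem_univ x)
  · intro hJ
    by_contra hc
    have hc0 : c = 1 := by
      clear hs hJ
      change ¬ c 0 = 1 at hc
      revert c
      decide
    subst hc0
    obtain ⟨l, hl⟩ := hJ
    have := semiconj_zpow (f := Prod.snd) (p := (twistedRotation k 1).1) (q := 1)
      (fun x => by simp [twistedRotation, Equiv.prodShear]) l (0, 0)
    rw [hl] at this
    simp at this
  · intro hc
    have h := sameCycle_twistedRotation c (Fin.last k) 0
    rwa [← Equiv.Perm.sameCycle_apply_right, twistedRotation_last, hc] at h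

theorem type_twistedRotation (k : ℕ) : type (twistedRotation k 1) = ({k + 1}, 0) ∧
    type (twistedRotation k (Equiv.swap 0 1)) = (0, {k + 1}) := by
  constructor <;> refine type_eq_of_signatureCount ?_ ?_ ?_ ?_ <;>
    intro m <;>
    simp only [Multiset.mem_singleton, Multiset.notMem_zero, IsEmpty.forall_iff, signatureCount,
      signature_twistedRotation, Prod.mk.injEq, Multiset.count_zero, Multiset.count_singleton]
  all_goals first | omega | skip
  all_goals
    by_cases hm : m = k + 1
    · subst hm
      simp
    · simp [hm, Ne.symm hm]

theorem exists_type_eq {lam del : Multiset ℕ} (hl : IsPartition lam) (hd : IsPartition del) {n : ℕ}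
    (hn : lam.sum + del.sum = n) : ∃ w : H n, type w = (lam, del) := by
  induction lam using Multiset.induction generalizing n with
  | cons m s ih =>
    obtain ⟨k, rfl⟩ := Nat.exists_eq_add_of_le' (hl m (by simp))
    obtain ⟨w, hw⟩ := ih (fun i hi => hl i (by simp [hi])) rfl
    obtain ⟨u, hu⟩ := exists_type_add (twistedRotation k 1) w
    have e : k + 1 + (s.sum + del.sum) = n := by rw [← hn, Multiset.sum_cons, ← add_assoc]
    subst e
    refine ⟨u, ?_⟩
    rw [hu, hw, (type_twistedRotation k).1]
    simp
  | empty =>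
    induction del using Multiset.induction generalizing n with
    | cons m s ih =>
      obtain ⟨k, rfl⟩ := Nat.exists_eq_add_of_le' (hd m (by simp))
      obtain ⟨w, hw⟩ := ih (fun i hi => hd i (by simp [hi])) rfl
      obtain ⟨u, hu⟩ := exists_type_add (twistedRotation k (Equiv.swap 0 1)) w
      have e : k + 1 + ((0 : Multiset ℕ).sum + s.sum) = n := by
        rw [← hn, Multiset.sum_cons, Multiset.sum_zero, zero_add, zero_add]
      subst e
      refine ⟨u, ?_⟩
      rw [hu, hw, (type_twistedRotation k).2]
      simp
    | empty =>
      obtain rfl : 0 = n := by simpa using hn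
      exact ⟨1, type_eq_of_signatureCount hl hd (by simp [signatureCount])
        (by simp [signatureCount])⟩

/-! ### Class sums as a basis of the center -/

open Classical in
theorem coeff_classSum (x : ProperPair) (n : ℕ) (t : H n) :
    (classSum x n).coeff t = if type t = x.complete n then 1 else 0 := by
  rw [classSum, MonoidAlgebra.coeff_sum, Finset.sum_apply']
  simp [MonoidAlgebra.of_apply, Finsupp.single_apply]

theorem classSum_mem_center (x : ProperPair) (n : ℕ) : classSum x n ∈ Z n := by
  rw [Subalgebra.mem_center_iff]
  intro f
  induction f using MonoidAlgebra.induction_linear with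
  | zero => simp
  | add f g hf hg => rw [add_mul, mul_add, hf, hg]
  | single g c =>
    ext t
    rw [MonoidAlgebra.coeff_single_mul_apply, MonoidAlgebra.coeff_mul_single_apply, mul_comm]
    congr 1
    rw [coeff_classSum, coeff_classSum, ← type_conj g (g⁻¹ * t)]
    simp

theorem coeff_conj_of_mem_center {n : ℕ} {f : MonoidAlgebra ℂ (H n)} (hf : f ∈ Z n) (g t : H n) :
    f.coeff (g * t * g⁻¹) = f.coeff t := by
  have h := Subalgebra.mem_center_iff.1 hf (MonoidAlgebra.single g 1)
  have h2 := congrArg (fun f => f.coeff (g * t)) h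
  simp only [MonoidAlgebra.coeff_single_mul_apply, MonoidAlgebra.coeff_mul_single_apply] at h2
  simpa using h2.symm

theorem ProperPair.complete_injective (n : ℕ) :
    Function.Injective fun x : ProperPair => x.complete n := by
  rintro ⟨l, d, hl, hd, hp⟩ ⟨l', d', hl', hd', hp'⟩ h
  have key : ∀ (l : Multiset ℕ) (k : ℕ), 1 ∉ l →
      (l + Multiset.replicate k 1).filter (· ≠ 1) = l := by
    intro l k hl
    rw [Multiset.filter_add, Multiset.filter_eq_self.2 fun a ha => ne_of_mem_of_not_mem ha hl,
      Multiset.filter_eq_nil.2 fun a ha => by simp [Multiset.eq_of_mem_replicate ha], add_zero]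
  have h1 := congrArg (fun p => p.1.filter (· ≠ 1)) h
  simp only [ProperPair.complete] at h1
  rw [key _ _ hp, key _ _ hp'] at h1
  have h2 : d = d' := congrArg Prod.snd h
  subst h1 h2
  rfl

theorem exists_type_eq_complete (x : ProperPair) {n : ℕ} (hx : x.size ≤ n) :
    ∃ w : H n, type w = x.complete n := by
  refine exists_type_eq (x.isPartition_lam.add fun m hm => (Multiset.eq_of_mem_replicate hm).ge)
    x.isPartition_del ?_
  rw [Multiset.sum_add, Multiset.sum_replicate, smul_eq_mul, mul_one]
  unfold ProperPair.size at *
  omega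

theorem exists_complete_eq_type {n : ℕ} (w : H n) :
    ∃ x : ProperPair, x.size ≤ n ∧ type w = x.complete n := by
  let x : ProperPair :=
    { lam := (type w).1.filter (· ≠ 1)
      del := (type w).2
      isPartition_lam := fun m hm => isPartition_type_fst w m (Multiset.mem_of_mem_filter hm)
      isPartition_del := isPartition_type_snd w
      proper := by simp }
  have h1 : x.lam + Multiset.replicate ((type w).1.count 1) 1 = (type w).1 := by
    conv_rhs => rw [← Multiset.filter_add_not (· ≠ 1) (type w).1]
    congr 1
    simp only [ne_eq, not_not]
    exact (Multiset.filter_eq' _ _).symm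
  have h2 : x.size + (type w).1.count 1 = n := by
    have h3 := sum_type w
    rw [← h1, Multiset.sum_add, Multiset.sum_replicate, smul_eq_mul, mul_one] at h3
    have : x.size = x.lam.sum + (type w).2.sum := rfl
    omega
  refine ⟨x, by omega, Prod.ext ?_ rfl⟩
  rw [← h1, ProperPair.complete]
  congr 2
  omega

/-- An element of the completed type of `z`. -/
def representative {n : ℕ} (z : {z : ProperPair // z.size ≤ n}) : H n :=
  (exists_type_eq_complete z.1 z.2).choose

theorem type_representative {n : ℕ} (z : {z : ProperPair // z.size ≤ n}) :
    type (representative z) = z.1.complete n :=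
  (exists_type_eq_complete z.1 z.2).choose_spec

theorem representative_injective (n : ℕ) :
    Function.Injective (representative : {z : ProperPair // z.size ≤ n} → H n) := by
  intro z z' h
  refine Subtype.ext (ProperPair.complete_injective n ?_)
  simp only [← type_representative, h]

instance (n : ℕ) : Finite {z : ProperPair // z.size ≤ n} :=
  Finite.of_injective _ (representative_injective n)

/-- The values of a central element on the representatives of the classes. -/
def classValues (n : ℕ) : Z n →ₗ[ℂ] ({z : ProperPair // z.size ≤ n} → ℂ) where
  toFun f z := f.1.coeff (representative z)
  map_add' _ _ := rfl
  map_smul' _ _ := rfl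

theorem coeff_eq_of_type_eq {n : ℕ} (f : Z n) {s t : H n} (h : type s = type t) :
    f.1.coeff s = f.1.coeff t := by
  obtain ⟨g, rfl⟩ := exists_conj_of_type_eq h
  exact (coeff_conj_of_mem_center f.2 g s).symm

/-- The class sum as an element of the center. -/
def centralClassSum {n : ℕ} (z : {z : ProperPair // z.size ≤ n}) : Z n :=
  ⟨classSum z.1 n, classSum_mem_center z.1 n⟩

open Classical in
theorem classValues_centralClassSum {n : ℕ} (z : {z : ProperPair // z.size ≤ n}) :
    classValues n (centralClassSum z) = Pi.single z 1 := by
  ext z'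
  change (classSum z.1 n).coeff (representative z') = _
  rw [coeff_classSum, type_representative, Pi.single_apply]
  refine if_congr ?_ rfl rfl
  rw [(ProperPair.complete_injective n).eq_iff, Subtype.ext_iff]

/-- A central element is constant on types, so its values on representatives determine it; the class
sums realize the indicator functions. -/
theorem classValues_bijective (n : ℕ) : Function.Bijective (classValues n) := by
  classical
  constructor
  · intro f g h
    refine Subtype.ext ?_
    ext t
    obtain ⟨x, hx, ht⟩ := exists_complete_eq_type t
    rw [← type_representative ⟨x, hx⟩] at ht
    rw [coeff_eq_of_type_eq f ht, coeff_eq_of_type_eq g ht]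
    exact congrFun h ⟨x, hx⟩
  · intro c
    have := Fintype.ofFinite {z : ProperPair // z.size ≤ n}
    refine ⟨∑ z, c z • centralClassSum z, ?_⟩
    ext z
    simp [classValues_centralClassSum, Pi.single_apply]

/-- The basis of the center formed by the class sums. -/
def classBasis (n : ℕ) : Module.Basis {z : ProperPair // z.size ≤ n} ℂ (Z n) :=
  Module.Basis.ofEquivFun (LinearEquiv.ofBijective (classValues n) (classValues_bijective n))

theorem classBasis_repr {n : ℕ} (f : Z n) (z : {z : ProperPair // z.size ≤ n}) :
    (classBasis n).repr f z = f.1.coeff (representative z) := by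
  rw [classBasis, Module.Basis.ofEquivFun_repr_apply]
  rfl

theorem classBasis_apply {n : ℕ} (z : {z : ProperPair // z.size ≤ n}) :
    classBasis n z = centralClassSum z := by
  classical
  rw [classBasis, Module.Basis.coe_ofEquivFun, LinearEquiv.symm_apply_eq]
  exact (classValues_centralClassSum z).symm

/-! ### Structure coefficients as numbers of factorizations -/

open Classical in
/-- The factorizations `u * v = t` with `u` and `v` of the completed types of `x` and `y`. -/
def factorizations (x y : ProperPair) {n : ℕ} (t : H n) : Finset (H n × H n) :=
  Finset.univ.filter fun p => type p.1 = x.complete n ∧ type p.2 = y.complete n ∧ p.1 * p.2 = t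

theorem coeff_classSum_mul_classSum (x y : ProperPair) {n : ℕ} (t : H n) :
    (classSum x n * classSum y n).coeff t = (factorizations x y t).card := by
  classical
  rw [classSum, classSum, Finset.sum_mul_sum, ← Finset.sum_product', MonoidAlgebra.coeff_sum,
    Finset.sum_apply']
  simp only [MonoidAlgebra.of_apply, MonoidAlgebra.single_mul_single, mul_one,
    MonoidAlgebra.coeff_single, Finsupp.single_apply]
  rw [Finset.sum_boole, Nat.cast_inj]
  congr 1
  ext p
  simp [factorizations, and_assoc]

theorem classBasis_repr_mul (x y h : ProperPair) {n : ℕ} (hx : x.size ≤ n) (hy : y.size ≤ n)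
    (hh : h.size ≤ n) {t : H n} (ht : type t = h.complete n) :
    (classBasis n).repr (classBasis n ⟨x, hx⟩ * classBasis n ⟨y, hy⟩) ⟨h, hh⟩ =
      (factorizations x y t).card := by
  rw [classBasis_repr, classBasis_apply, classBasis_apply,
    coeff_eq_of_type_eq _ ((type_representative ⟨h, hh⟩).trans ht.symm)]
  exact coeff_classSum_mul_classSum x y t

theorem extend_trans {a b c : ℕ} (φ : Fin a ↪ Fin b) (ψ : Fin b ↪ Fin c) (w : H a) :
    extend (φ.trans ψ) w = extend ψ (extend φ w) := by
  refine Subtype.ext (Equiv.ext ?_)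
  rintro ⟨i, d⟩
  by_cases hi : i ∈ Set.range ψ
  · obtain ⟨j, rfl⟩ := hi
    change _ = (extend ψ _).1 (pointEmbedding ψ (j, d))
    rw [extend_apply]
    by_cases hj : j ∈ Set.range φ
    · obtain ⟨l, rfl⟩ := hj
      change (extend (φ.trans ψ) w).1 (pointEmbedding (φ.trans ψ) (l, d)) =
        pointEmbedding ψ ((extend φ w).1 (pointEmbedding φ (l, d)))
      rw [extend_apply, extend_apply]
      rfl
    · rw [extend_apply_of_notMem φ w (j, d) hj, extend_apply_of_notMem (φ.trans ψ)]
      · rfl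
      · rintro ⟨l, hl⟩
        exact hj ⟨l, ψ.injective hl⟩
  · rw [extend_apply_of_notMem ψ _ (i, d) hi, extend_apply_of_notMem (φ.trans ψ)]
    rintro ⟨l, hl⟩
    exact hi ⟨φ l, hl⟩

/-! ### Sorting factorizations by the blocks they move -/

open Classical in
/-- The blocks that are not fixed pointwise by both components of `p`. -/
def movedBlocks {n : ℕ} (p : H n × H n) : Finset (Fin n) :=
  Finset.univ.filter fun i => ¬ (Fixes p.1 i ∧ Fixes p.2 i)

theorem mem_movedBlocks {n : ℕ} {p : H n × H n} {i : Fin n} :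
    i ∈ movedBlocks p ↔ ¬ (Fixes p.1 i ∧ Fixes p.2 i) := by
  simp [movedBlocks]

theorem mem_factorizations {x y : ProperPair} {n : ℕ} {t : H n} {p : H n × H n} :
    p ∈ factorizations x y t ↔
      type p.1 = x.complete n ∧ type p.2 = y.complete n ∧ p.1 * p.2 = t := by
  simp [factorizations]

theorem card_movedBlocks_le {x y : ProperPair} {n : ℕ} {t : H n} {p : H n × H n}
    (hp : p ∈ factorizations x y t) : (movedBlocks p).card ≤ x.size + y.size := by
  classical
  obtain ⟨h1, h2, -⟩ := mem_factorizations.1 hp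
  rw [← card_not_fixes p.1 x h1, ← card_not_fixes p.2 y h2]
  refine (Finset.card_le_card fun i hi => ?_).trans (Finset.card_union_le _ _)
  rw [mem_movedBlocks, not_and_or] at hi
  simpa using hi

/-- The factorizations of `t` that move all blocks. -/
def fullFactorizations (x y : ProperPair) {n : ℕ} (t : H n) : Finset (H n × H n) :=
  (factorizations x y t).filter fun p => movedBlocks p = Finset.univ

/-- A pair fixing every block outside the range of `φ` is the extension of a unique pair in `H a`,
with types and products corresponding. -/
theorem card_factorizations_extend (x y : ProperPair) {a b : ℕ} (hx : x.size ≤ b)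
    (hy : y.size ≤ b) (φ : Fin a ↪ Fin b) (t : H a) :
    ((factorizations x y (extend φ t)).filter fun p =>
      movedBlocks p = Finset.univ.map φ).card = (fullFactorizations x y t).card := by
  symm
  refine Finset.card_bij (fun p _ => (extend φ p.1, extend φ p.2)) ?_ ?_ ?_
  · rintro ⟨u, v⟩ h
    rw [fullFactorizations, Finset.mem_filter, mem_factorizations] at h
    obtain ⟨⟨hu, hv, huv⟩, hm⟩ := h
    rw [Finset.mem_filter, mem_factorizations]
    refine ⟨⟨(type_extend_eq_complete_iff φ u x hx).2 hu,
      (type_extend_eq_complete_iff φ v y hy).2 hv, by rw [← huv, map_mul]⟩, ?_⟩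
    ext i
    rw [mem_movedBlocks]
    by_cases hi : i ∈ Set.range φ
    · obtain ⟨j, rfl⟩ := hi
      have hj : j ∈ movedBlocks (u, v) := hm ▸ Finset.mem_univ j
      rw [mem_movedBlocks] at hj
      simpa [fixes_extend_iff] using hj
    · refine iff_of_false (fun h => h ⟨fixes_extend_of_notMem φ u i hi,
        fixes_extend_of_notMem φ v i hi⟩) fun h => hi ?_
      obtain ⟨j, -, hj⟩ := Finset.mem_map.1 h
      exact ⟨j, hj⟩
  · rintro ⟨u, v⟩ - ⟨u', v'⟩ - h
    rw [Prod.mk.injEq, (extend_injective φ).eq_iff, (extend_injective φ).eq_iff] at h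
    exact Prod.ext h.1 h.2
  · rintro ⟨u, v⟩ h
    rw [Finset.mem_filter, mem_factorizations] at h
    obtain ⟨⟨hu, hv, huv⟩, hm⟩ := h
    have hfix : ∀ i, i ∉ Set.range φ → Fixes u i ∧ Fixes v i := by
      intro i hi
      by_contra hc
      have : i ∈ movedBlocks (u, v) := mem_movedBlocks.2 hc
      rw [hm, Finset.mem_map] at this
      obtain ⟨j, -, hj⟩ := this
      exact hi ⟨j, hj⟩
    obtain ⟨u, rfl⟩ := exists_extend_eq φ u fun i hi => (hfix i hi).1
    obtain ⟨v, rfl⟩ := exists_extend_eq φ v fun i hi => (hfix i hi).2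
    refine ⟨(u, v), ?_, rfl⟩
    rw [fullFactorizations, Finset.mem_filter, mem_factorizations]
    refine ⟨⟨(type_extend_eq_complete_iff φ u x hx).1 hu,
      (type_extend_eq_complete_iff φ v y hy).1 hv, extend_injective φ ?_⟩, ?_⟩
    · rw [map_mul]
      exact huv
    · ext i
      have hi : φ i ∈ movedBlocks (extend φ u, extend φ v) := by simp [hm]
      rw [mem_movedBlocks] at hi ⊢
      simpa [fixes_extend_iff] using hi

/-- The embedding of blocks that is the identity on the first `s` blocks and sends the others, in
order, to the blocks indexed by `T`. -/
def subsetEmbedding (s : ℕ) {j k : ℕ} (T : Finset (Fin k)) (hT : T.card = j) :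
    Fin (s + j) ↪ Fin (s + k) :=
  finSumFinEquiv.symm.toEmbedding.trans
    (((Function.Embedding.refl (Fin s)).sumMap (T.orderEmbOfFin hT).toEmbedding).trans
      finSumFinEquiv.toEmbedding)

theorem subsetEmbedding_castAdd {s j k : ℕ} (T : Finset (Fin k)) (hT : T.card = j) (i : Fin s) :
    subsetEmbedding s T hT (Fin.castAdd j i) = Fin.castAdd k i := by
  simp [subsetEmbedding]

theorem subsetEmbedding_natAdd {s j k : ℕ} (T : Finset (Fin k)) (hT : T.card = j) (i : Fin j) :
    subsetEmbedding s T hT (Fin.natAdd s i) = Fin.natAdd s (T.orderEmbOfFin hT i) := by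
  simp [subsetEmbedding]

theorem castAdd_mem_map_subsetEmbedding {s j k : ℕ} (T : Finset (Fin k)) (hT : T.card = j)
    (i : Fin s) : Fin.castAdd k i ∈ Finset.univ.map (subsetEmbedding s T hT) :=
  Finset.mem_map.2 ⟨Fin.castAdd j i, Finset.mem_univ _, subsetEmbedding_castAdd T hT i⟩

theorem natAdd_mem_map_subsetEmbedding {s j k : ℕ} (T : Finset (Fin k)) (hT : T.card = j)
    (i : Fin k) : Fin.natAdd s i ∈ Finset.univ.map (subsetEmbedding s T hT) ↔ i ∈ T := by
  rw [← Finset.mem_coe (s := T), ← Finset.range_orderEmbOfFin T hT, Finset.mem_map]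
  constructor
  · rintro ⟨l, -, hl⟩
    induction l using Fin.addCases with
    | left l =>
      rw [subsetEmbedding_castAdd] at hl
      have := congrArg Fin.val hl
      simp only [Fin.val_castAdd, Fin.val_natAdd] at this
      omega
    | right l =>
      rw [subsetEmbedding_natAdd] at hl
      exact ⟨l, Fin.natAdd_injective _ _ hl⟩
  · rintro ⟨l, rfl⟩
    exact ⟨Fin.natAdd s l, Finset.mem_univ _, subsetEmbedding_natAdd T hT l⟩

/-- Because of this, the fibre over `T` is counted by full factorizations of an element that depends
on `T.card` only. -/
theorem castAddEmb_trans_subsetEmbedding {s j k : ℕ} (T : Finset (Fin k)) (hT : T.card = j) :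
    (Fin.castAddEmb j).trans (subsetEmbedding s T hT) = Fin.castAddEmb k :=
  Function.Embedding.ext fun i => subsetEmbedding_castAdd T hT i

theorem card_factorizations_eq_sum (x y : ProperPair) {s k : ℕ} (t : H s) (ht : ∀ i, ¬ Fixes t i)
    (hx : x.size ≤ s + k) (hy : y.size ≤ s + k) :
    (factorizations x y (extend (Fin.castAddEmb k) t)).card =
      ∑ j ∈ Finset.range (k + 1),
        k.choose j * (fullFactorizations x y (extend (Fin.castAddEmb j) t)).card := by
  classical
  have h := Finset.sum_powerset_apply_card
    (fun j => (fullFactorizations x y (extend (Fin.castAddEmb j) t)).card)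
    (x := (Finset.univ : Finset (Fin k)))
  simp only [Finset.card_univ, Fintype.card_fin, smul_eq_mul] at h
  rw [← h, Finset.card_eq_sum_card_fiberwise
    (f := fun p => Finset.univ.filter fun i : Fin k => Fin.natAdd s i ∈ movedBlocks p)
    (t := (Finset.univ : Finset (Fin k)).powerset)
    fun p _ => Finset.mem_coe.2 (Finset.mem_powerset.2 (Finset.subset_univ _))]
  refine Finset.sum_congr rfl fun T _ => ?_
  rw [← card_factorizations_extend x y hx hy (subsetEmbedding s T rfl), ← extend_trans,
    castAddEmb_trans_subsetEmbedding]
  congr 1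
  refine Finset.filter_congr fun p hp => ?_
  obtain ⟨-, -, hpt⟩ := mem_factorizations.1 hp
  -- If both factors fixed one of the first `s` blocks, so would their product, against `ht`. Thus
  -- the moved set is determined by its extra blocks.
  have hc : ∀ i : Fin s, Fin.castAdd k i ∈ movedBlocks p := by
    intro i
    rw [mem_movedBlocks]
    rintro ⟨h1, h2⟩
    refine ht i ((fixes_extend_iff (Fin.castAddEmb k) t i).1 fun b => ?_)
    rw [← hpt]
    change p.1.1 (p.2.1 (Fin.castAdd k i, b)) = (Fin.castAdd k i, b)
    rw [h2, h1]
  constructor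
  · intro hT
    ext i
    induction i using Fin.addCases with
    | left i => exact iff_of_true (hc i) (castAdd_mem_map_subsetEmbedding T rfl i)
    | right i =>
      rw [natAdd_mem_map_subsetEmbedding, ← hT]
      simp
  · intro hT
    ext i
    rw [hT, Finset.mem_filter_univ]
    exact natAdd_mem_map_subsetEmbedding T rfl i

theorem fullFactorizations_eq_empty (x y : ProperPair) {n : ℕ} (t : H n)
    (h : x.size + y.size < n) : fullFactorizations x y t = ∅ := by
  refine Finset.filter_eq_empty_iff.2 fun p hp hm => ?_
  have := card_movedBlocks_le hp
  rw [hm, Finset.card_univ, Fintype.card_fin] at this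
  omega

/-! ### The polynomial, its coefficients and its degree -/

theorem fallingSum_eval (m k : ℕ) (a : ℕ →₀ ℚ) :
    (fallingSum m a).eval ((m + k : ℕ) : ℚ) = a.sum fun j c => c * (k.descFactorial j : ℚ) := by
  rw [fallingSum, Finsupp.sum, eval_finsetSum, Finsupp.sum]
  refine Finset.sum_congr rfl fun j _ => ?_
  rw [eval_mul, eval_C, eval_comp, eval_sub, eval_X, eval_C, Nat.cast_add, add_sub_cancel_left,
    descPochhammer_eval_eq_descFactorial]

theorem fallingSum_degree_add_le {m d : ℕ} {a : ℕ →₀ ℚ} (ha : ∀ j, a j ≠ 0 → j + m ≤ d) :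
    (fallingSum m a).degree + (m : WithBot ℕ) ≤ (d : WithBot ℕ) := by
  by_cases hd : m ≤ d
  · have h1 : (fallingSum m a).degree ≤ ((d - m : ℕ) : WithBot ℕ) := by
      refine degree_le_of_natDegree_le (natDegree_sum_le_of_forall_le _ _ fun j hj => ?_)
      refine (natDegree_C_mul_le _ _).trans ((natDegree_comp_le).trans ?_)
      rw [natDegree_X_sub_C, mul_one, descPochhammer_natDegree]
      have := ha j (Finsupp.mem_support_iff.1 hj)
      omega
    calc _ ≤ ((d - m : ℕ) : WithBot ℕ) + (m : WithBot ℕ) := by gcongr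
      _ = ((d - m + m : ℕ) : WithBot ℕ) := rfl
      _ = _ := by rw [Nat.sub_add_cancel hd]
  -- For `d < m` no coefficient survives, and the degree `⊥` absorbs the summand `m`.
  · have h0 : a = 0 := by
      ext j
      by_contra hj
      have := ha j hj
      omega
    simp [h0, fallingSum]

theorem exists_fallingSum (x y h : ProperPair) :
    ∃ a : ℕ →₀ ℚ,
      (∀ (n : ℕ) (hx : x.size ≤ n) (hy : y.size ≤ n) (hh : h.size ≤ n),
        (classBasis n).repr (classBasis n ⟨x, hx⟩ * classBasis n ⟨y, hy⟩) ⟨h, hh⟩ =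
          (((fallingSum h.size a).eval (n : ℚ) : ℚ) : ℂ)) ∧
      (∀ j, 0 ≤ a j) ∧ ∀ j, a j ≠ 0 → j + h.size ≤ x.size + y.size := by
  classical
  obtain ⟨t, ht⟩ := exists_type_eq_complete h le_rfl
  have hfix : ∀ i, ¬ Fixes t i := by
    have h1 := (card_not_fixes t h ht).trans (Finset.card_fin h.size).symm
    rw [Finset.card_filter_eq_iff] at h1
    exact fun i => h1 i (Finset.mem_univ i)
  let N : ℕ → ℕ := fun j => (fullFactorizations x y (extend (Fin.castAddEmb j) t)).card
  have hN : ∀ j, N j ≠ 0 → j + h.size ≤ x.size + y.size := by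
    intro j hj
    by_contra hlt
    refine hj (Finset.card_eq_zero.2 (fullFactorizations_eq_empty x y _ ?_))
    omega
  have hne : ∀ j, (N j : ℚ) / (j.factorial : ℚ) ≠ 0 → N j ≠ 0 := fun j hj h0 => hj (by simp [h0])
  let a : ℕ →₀ ℚ := Finsupp.onFinset (Finset.range (x.size + y.size + 1))
    (fun j => (N j : ℚ) / (j.factorial : ℚ)) fun j hj => by
      have := hN j (hne j hj)
      rw [Finset.mem_range]
      omega
  refine ⟨a, ?_, fun j => by simp only [a, Finsupp.onFinset_apply]; positivity,
    fun j hj => hN j (hne j hj)⟩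
  intro n hx hy hh
  obtain ⟨k, rfl⟩ := Nat.exists_eq_add_of_le hh
  rw [classBasis_repr_mul x y h hx hy hh
    ((type_extend_eq_complete_iff (Fin.castAddEmb k) t h hh).2 ht), fallingSum_eval,
    card_factorizations_eq_sum x y t hfix hx hy]
  -- This range contains both the support of `a` and `Finset.range (k + 1)`; the additional terms
  -- vanish on either side, the binomials being zero for `j > k`.
  have hs : a.support ⊆ Finset.range (x.size + y.size + 1 + (k + 1)) := fun j hj => by
    have := hN j (hne j (Finsupp.mem_support_iff.1 hj))
    rw [Finset.mem_range]
    omega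
  rw [Finsupp.sum_of_support_subset a hs _ fun _ _ => by simp,
    Finset.sum_subset (Finset.range_subset_range.2 (Nat.le_add_left (k + 1) (x.size + y.size + 1)))
      fun j _ hj => by
        rw [Nat.choose_eq_zero_of_lt (by simpa using hj), zero_mul]]
  rw [Nat.cast_sum, Rat.cast_sum]
  refine Finset.sum_congr rfl fun j _ => ?_
  have hj : (j.factorial : ℚ) ≠ 0 := Nat.cast_ne_zero.2 j.factorial_ne_zero
  have : a j * (k.descFactorial j : ℚ) = ((k.choose j * N j : ℕ) : ℚ) := by
    simp only [a, Finsupp.onFinset_apply]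
    rw [Nat.descFactorial_eq_factorial_mul_choose]
    push_cast
    field_simp
  rw [this, Rat.cast_natCast]

end Hyperoctahedral

end

theorem mainTheorem8 :
    ∃ b : ∀ n : ℕ, Module.Basis {z : Hyperoctahedral.ProperPair // z.size ≤ n} ℂ
        (Hyperoctahedral.Z n),
      (∀ (n : ℕ) (z : {z : Hyperoctahedral.ProperPair // z.size ≤ n}),
        (b n z : MonoidAlgebra ℂ (Hyperoctahedral.H n)) = Hyperoctahedral.classSum z.1 n) ∧
      ∀ x y h : Hyperoctahedral.ProperPair,
        ∃ (P : Polynomial ℚ) (a : ℕ →₀ ℚ),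
          (∀ (n : ℕ) (hx : x.size ≤ n) (hy : y.size ≤ n) (hh : h.size ≤ n),
            (b n).repr (b n ⟨x, hx⟩ * b n ⟨y, hy⟩) ⟨h, hh⟩ = ((P.eval (n : ℚ) : ℚ) : ℂ)) ∧
          (∀ j : ℕ, 0 ≤ a j) ∧
          P = Hyperoctahedral.fallingSum h.size a ∧
          P.degree + (h.size : WithBot ℕ) ≤ ((x.size + y.size : ℕ) : WithBot ℕ) := by
  refine ⟨Hyperoctahedral.classBasis, fun n z => ?_, fun x y h => ?_⟩
  · rw [Hyperoctahedral.classBasis_apply]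
    rfl
  · obtain ⟨a, h1, h2, h3⟩ := Hyperoctahedral.exists_fallingSum x y h
    exact ⟨_, a, h1, h2, rfl, Hyperoctahedral.fallingSum_degree_add_le h3⟩
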